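/- **Theorem 3.1.** Let $X$ be a rack, i.e. a set with a binary operation $*$ such that every map $s_x\colon X\to X$, $s_x(a)=a*x$, is bijective and $(x*y)*z=(x*z)*(y*z)$ for all $x,y,z\in X$. Let $\mathrm{Inn}(X)$ be the group of permutations of $X$ generated by all $s_x$, multiplied by opposite composition, so that it acts on $X$ from the right; let $\mathcal O_X$ be its set of orbits, and let $e_{[x]}$ denote the generator of the free abelian group $\mathbb Z^{\oplus\mathcal O_X}$ given by the orbit of $x$. Let $$\mathrm{As}(X)=\langle e_x\ (x\in X)\mid e_xe_y=e_ye_{x*y}\ (x,y\in X)\rangle,$$ let $\alpha\colon\mathrm{As}(X)\to\mathbb Z^{\oplus\mathcal O_X}$ and $\psi\colon\mathrm{As}(X)\to\mathrm{Inn}(X)$ be the homomorphisms with $\alpha(e_x)=e_{[x]}$ and $\psi(e_x)=s_x$, and let $A$ be the kernel and $\overline{\mathrm{Inn}}(X)$ the image of $\alpha\times\psi\colon\mathrm{As}(X)\to\mathbb Z^{\oplus\mathcal O_X}\times\mathrm{Inn}(X)$. Then $A$ is central in $\mathrm{As}(X)$. Put $\bar s_x=(\alpha\times\psi)(e_x)$,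 and let $\mathrm{Stab}_{\overline{\mathrm{Inn}}(X)}(x)$ be the stabilizer of $x$ for the right action of $\overline{\mathrm{Inn}}(X)$ on $X$ through the second projection; its elements commute with $\bar s_x$. Homology $H_2$ has coefficients in $\mathbb Z$, all coefficients are trivial modules, and for commuting elements $g,h$ of a group $G$ the Pontryagin product $\langle g,h\rangle\in H_2(G)$ is the class of the inhomogeneous cycle $[g|h]-[h|g]$. Then there is an isomorphism $$\theta\colon H_2(\overline{\mathrm{Inn}}(X))\Big/\sum_{x\in X}\langle\bar s_x,\mathrm{Stab}_{\overline{\mathrm{Inn}}(X)}(x)\rangle\ \xrightarrow{\ \cong\ }\ A,$$ where the denominator is the subgroup generated by all $\langle\bar s_x,h\rangle$ with $x\in X$ and $h\in\mathrm{Stab}_{\overline{\mathrm{Inn}}(X)}(x)$, with the following property. Let $\varphi\colon H_2(\overline{\mathrm{Inn}}(X))\to A$ be the quotient map followed by $\theta$. The evaluation map $$H^2(\overline{\mathrm{Inn}}(X),A)\to\mathrm{Hom}(H_2(\overline{\mathrm{Inn}}(X)),A),$$ which evaluates $2$-cocycles on $2$-cycles, is an isomorphism, and the central extension $$1\to A\to\mathrm{As}(X)\to\overline{\mathrm{Inn}}(X)\to1$$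 is equivalent to the extension associated with the class in $H^2(\overline{\mathrm{Inn}}(X),A)$ that corresponds to $\varphi$. Here the extension associated with the class of a $2$-cocycle $c$ is the set $A\times\overline{\mathrm{Inn}}(X)$ with multiplication $(a,g)(b,h)=(a\,b\,c(g,h),\,gh)$. -/

import Mathlib

universe u

open scoped Quandles

noncomputable section

/-! ## Integral group homology and cohomology in degree two -/

namespace GroupH2

/-- The ring of integers, placed in the universe of the group whose homology is taken. -/
abbrev Z : Type u := ULift.{u} ℤ

/-- The second homology group of `G` with (trivial) integral coefficients. -/
abbrev H₂ (G : Type u) [Group G] : Type u :=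
  groupHomology.H2 (Rep.trivial Z.{u} G Z.{u})

/-- The second cohomology group of `G` with coefficients in the trivial `G`-module `M`. -/
abbrev Hc₂ (G : Type u) [Group G] (M : Type u) [AddCommGroup M] : Type u :=
  groupCohomology.H2 (Rep.trivial Z.{u} G M)

/-- Inhomogeneous integral 2-cycles of `G`. -/
abbrev Cyc (G : Type u) [Group G] : Submodule Z.{u} (G × G →₀ Z.{u}) :=
  groupHomology.cycles₂ (Rep.trivial Z.{u} G Z.{u})

/-- Inhomogeneous 2-cocycles of `G` with values in the trivial `G`-module `M`. -/
abbrev Coc (G : Type u) [Group G] (M : Type u) [AddCommGroup M] : Submodule Z.{u} (G × G → M) :=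
  groupCohomology.cocycles₂ (Rep.trivial Z.{u} G M)

variable {G : Type u} [Group G] {M : Type u} [AddCommGroup M]

/-- The homology class of a 2-cycle. -/
def cycClass (G : Type u) [Group G] : Cyc G →+ H₂ G :=
  (groupHomology.H2π (Rep.trivial Z.{u} G Z.{u})).hom.toAddMonoidHom

/-- The cohomology class of a 2-cocycle. -/
def cocClass (G : Type u) [Group G] (M : Type u) [AddCommGroup M] : Coc G M →+ Hc₂ G M :=
  (groupCohomology.H2π (Rep.trivial Z.{u} G M)).hom.toAddMonoidHom

lemma cycClass_surjective : Function.Surjective (cycClass G) :=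
  (ModuleCat.epi_iff_surjective _).1 inferInstance

lemma cocClass_surjective : Function.Surjective (cocClass G M) :=
  (ModuleCat.epi_iff_surjective _).1 inferInstance

lemma coc_eq (c : Coc G M) (g h j : G) :
    c.1 (g * h, j) + c.1 (g, h) = c.1 (h, j) + c.1 (g, h * j) := by
  simpa using (groupCohomology.mem_cocycles₂_iff (A := Rep.trivial Z.{u} G M) c.1).1 c.2 g h j

/-- The value `∑ z(g,h) • c(g,h)` of a 2-cochain on a 2-chain. -/
def pair (c : G × G → M) : (G × G →₀ Z.{u}) →ₗ[Z.{u}] M := Finsupp.linearCombination Z.{u} c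

lemma pair_boundary (c : Coc G M) (z : Cyc G) (hz : cycClass G z = 0) : pair c.1 z.1 = 0 := by
  obtain ⟨y, hy⟩ := (groupHomology.H2π_eq_zero_iff (A := Rep.trivial Z.{u} G Z.{u}) z).1 hz
  have key : (pair c.1).comp (groupHomology.d₃₂ (Rep.trivial Z.{u} G Z.{u})).hom = 0 := by
    ext ⟨g, h, j⟩
    have := coc_eq c g h j
    simp [pair, groupHomology.d₃₂]
    rw [sub_add_eq_add_sub, sub_sub, this, sub_self]
  rw [← hy]
  exact congrArg (fun f => f y) key

lemma pair_coboundary (c : Coc G M) (hc : cocClass G M c = 0) (z : Cyc G) : pair c.1 z.1 = 0 := by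
  obtain ⟨y, hy⟩ := (groupCohomology.H2π_eq_zero_iff (A := Rep.trivial Z.{u} G M) c).1 hc
  have key : pair c.1 =
      (Finsupp.linearCombination Z.{u} y).comp
        (groupHomology.d₂₁ (Rep.trivial Z.{u} G Z.{u})).hom := by
    have hy' : c.1 = groupCohomology.d₁₂ (Rep.trivial Z.{u} G M) y := hy.symm
    ext ⟨g, h⟩
    rw [hy']
    simp [pair, groupHomology.d₂₁]
  rw [key, LinearMap.comp_apply]
  have hz : (groupHomology.d₂₁ (Rep.trivial Z.{u} G Z.{u})).hom z.1 = 0 := z.2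
  rw [hz, map_zero]

/-- The homomorphism `H₂(G) → M` given by evaluating a 2-cocycle on 2-cycles. -/
def evalCocycle (c : Coc G M) : H₂ G →+ M :=
  (cycClass G).liftOfSurjective cycClass_surjective
    ⟨((pair c.1).comp (Cyc G).subtype).toAddMonoidHom, fun z hz => pair_boundary c z hz⟩

lemma evalCocycle_cycClass (c : Coc G M) (z : Cyc G) :
    evalCocycle c (cycClass G z) = pair c.1 z.1 :=
  AddMonoidHom.liftOfRightInverse_comp_apply _ _ _ _ z

/-- The evaluation map `H²(G, M) → Hom(H₂(G), M)` of the universal coefficient theorem. -/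
def evaluation (G : Type u) [Group G] (M : Type u) [AddCommGroup M] :
    Hc₂ G M →+ (H₂ G →+ M) :=
  (cocClass G M).liftOfSurjective cocClass_surjective
    ⟨{ toFun := evalCocycle
       map_zero' := by
        ext x
        obtain ⟨z, rfl⟩ := cycClass_surjective x
        simp [evalCocycle_cycClass, pair]
       map_add' := fun c d => by
        ext x
        obtain ⟨z, rfl⟩ := cycClass_surjective x
        simp only [evalCocycle_cycClass, pair, AddMonoidHom.add_apply,
          Finsupp.linearCombination_apply, Finsupp.sum]
        simp [Finset.sum_add_distrib] },
      fun c hc => by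
        rw [AddMonoidHom.mem_ker]
        ext x
        obtain ⟨z, rfl⟩ := cycClass_surjective x
        simpa [evalCocycle_cycClass] using pair_coboundary c hc z⟩

/-- The evaluation map is computed on representatives by `∑ z(g,h) • c(g,h)`. -/
lemma evaluation_cocClass_cycClass (c : Coc G M) (z : Cyc G) :
    evaluation G M (cocClass G M c) (cycClass G z) = z.1.sum fun p n => n.down • c.1 p := by
  have h : evaluation G M (cocClass G M c) = evalCocycle c :=
    AddMonoidHom.liftOfRightInverse_comp_apply _ _ _ _ c
  rw [h, evalCocycle_cycClass]
  rfl

/-- The Pontryagin product `⟨g, h⟩ ∈ H₂(G)` of a commuting pair: the class of the inhomogeneous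
cycle `[g|h] - [h|g]`, i.e. the image of the generator `[(1,0)|(0,1)] - [(0,1)|(1,0)]` of
`H₂(ℤ × ℤ)` under the homomorphism `ℤ × ℤ → G` with `(1,0) ↦ g`, `(0,1) ↦ h`. -/
def pontryagin (g h : G) (hgh : Commute g h) : H₂ G :=
  cycClass G ⟨Finsupp.single (g, h) 1 - Finsupp.single (h, g) 1, by
    rw [groupHomology.mem_cycles₂_iff, Finsupp.sum_sub_index, Finsupp.sum_sub_index]
    · simp [hgh.eq, add_comm]
    · simp
    · simp [add_sub_add_comm]⟩

/-! ### Central extension defined by a cocycle -/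

variable {N : Type u} [CommGroup N]

/-- The set `N × G`, with the multiplication `(a, g)(b, h) = (a b c(g, h), g h)`. -/
@[ext]
structure CocycleGroup (c : Coc G (Additive N)) where
  /-- the component in the kernel -/
  left : N
  /-- the component in the quotient -/
  right : G

namespace CocycleGroup

variable (c : Coc G (Additive N))

/-- The cocycle written multiplicatively. -/
def mulCoc (g h : G) : N := Additive.toMul (c.1 (g, h))

lemma mulCoc_eq (g h j : G) :
    mulCoc c (g * h) j * mulCoc c g h = mulCoc c h j * mulCoc c g (h * j) :=
  congrArg Additive.toMul (coc_eq c g h j)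

lemma mulCoc_one_left (g : G) : mulCoc c 1 g = mulCoc c 1 1 := by
  simpa using (mulCoc_eq c 1 1 g).symm

lemma mulCoc_one_right (g : G) : mulCoc c g 1 = mulCoc c 1 1 := by
  simpa using mulCoc_eq c g 1 1

instance : Mul (CocycleGroup c) :=
  ⟨fun a b => ⟨a.left * b.left * mulCoc c a.right b.right, a.right * b.right⟩⟩

instance : One (CocycleGroup c) := ⟨⟨(mulCoc c 1 1)⁻¹, 1⟩⟩

instance : Inv (CocycleGroup c) :=
  ⟨fun a => ⟨(a.left * mulCoc c a.right⁻¹ a.right * mulCoc c 1 1)⁻¹, a.right⁻¹⟩⟩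

@[simp] lemma mul_left (a b : CocycleGroup c) :
    (a * b).left = a.left * b.left * mulCoc c a.right b.right := rfl
@[simp] lemma mul_right (a b : CocycleGroup c) : (a * b).right = a.right * b.right := rfl
@[simp] lemma one_left : (1 : CocycleGroup c).left = (mulCoc c 1 1)⁻¹ := rfl
@[simp] lemma one_right : (1 : CocycleGroup c).right = 1 := rfl
@[simp] lemma inv_left (a : CocycleGroup c) :
    (a⁻¹).left = (a.left * mulCoc c a.right⁻¹ a.right * mulCoc c 1 1)⁻¹ := rfl
@[simp] lemma inv_right (a : CocycleGroup c) : (a⁻¹).right = a.right⁻¹ := rfl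

instance : Group (CocycleGroup c) :=
  Group.ofLeftAxioms
    (fun a b d => by
      ext
      · have := mulCoc_eq c a.right b.right d.right
        simp only [mul_left, mul_right]
        calc _ = a.left * b.left * d.left *
              (mulCoc c (a.right * b.right) d.right * mulCoc c a.right b.right) := by
              simp only [mul_assoc, mul_comm, mul_left_comm]
          _ = _ := by rw [this]; simp only [mul_assoc, mul_comm, mul_left_comm]
      · simp [mul_assoc])
    (fun a => by ext <;> simp [mulCoc_one_left, mul_comm])
    (fun a => by
      ext
      · simp only [mul_left, inv_left, inv_right, one_left, mul_inv]
        rw [mul_right_comm _ _ a.left, mul_right_comm _ _ a.left, inv_mul_cancel, one_mul,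
          mul_right_comm, inv_mul_cancel, one_mul]
      · simp)

end CocycleGroup

/-- The central extension `1 → N → N ×_c G → G → 1` defined by the 2-cocycle `c`. -/
def cocycleExtension (c : Coc G (Additive N)) : GroupExtension N (CocycleGroup c) G where
  inl :=
    { toFun := fun a => ⟨a * (CocycleGroup.mulCoc c 1 1)⁻¹, 1⟩
      map_one' := by ext <;> simp
      map_mul' := fun a b => by
        ext <;> simp [mul_assoc, mul_left_comm] }
  rightHom :=
    { toFun := fun a => a.right
      map_one' := rfl
      map_mul' := fun _ _ => rfl }
  inl_injective := fun a b h => by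
    have := congrArg CocycleGroup.left h
    simpa using this
  range_inl_eq_ker_rightHom := by
    ext a
    constructor
    · rintro ⟨b, rfl⟩
      rfl
    · intro h
      refine ⟨a.left * CocycleGroup.mulCoc c 1 1, ?_⟩
      ext
      · simp
      · exact (show a.right = 1 from h).symm
  rightHom_surjective := fun g => ⟨⟨1, g⟩, rfl⟩

/-- The group extension `S` is (equivalent to) the central extension associated with the
cohomology class `κ ∈ H²(G, N)`. -/
def HasClass {E : Type u} [Group E] (S : GroupExtension N E G) (κ : Hc₂ G (Additive N)) : Prop :=
  ∃ c : Coc G (Additive N), cocClass G (Additive N) c = κ ∧ Nonempty (S.Equiv (cocycleExtension c))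

end GroupH2

/-! ## Groups attached to a rack

A right rack operation `a * x` is written `x ◃ a`, so that `Rack.act' x` is the permutation
`s_x : a ↦ a * x`. -/

namespace AssocGroup

open MulOpposite GroupH2

variable (X : Type u) [Rack X]

/-- The relators of `e_x e_y = e_y e_{x*y}`. -/
def rels : Set (FreeGroup X) :=
  {r | ∃ x y : X, r = FreeGroup.of x * FreeGroup.of y *
    (FreeGroup.of y * FreeGroup.of (y ◃ x))⁻¹}

/-- The associated group `⟨e_x (x ∈ X) ∣ e_x e_y = e_y e_{x*y}⟩` of the rack `X`. -/
abbrev As : Type u := PresentedGroup (rels X)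

/-- The inner automorphism group, generated by the `s_x`, multiplied by opposite composition. -/
def Inn : Subgroup (Equiv.Perm X)ᵐᵒᵖ :=
  Subgroup.closure (Set.range fun x : X => op (Rack.act' x))

variable {X}

/-- The generator `e_x` of the associated group. -/
def e (x : X) : As X := PresentedGroup.of x

/-- The right action `x · g` of `Inn X` on `X`. -/
def actInn (x : X) (g : Inn X) : X := (unop g.1) x

lemma actInn_one (x : X) : actInn x 1 = x := rfl

lemma actInn_mul (x : X) (g h : Inn X) : actInn x (g * h) = actInn (actInn x g) h := rfl

/-- The inner automorphism `s_x`, as an element of `Inn X`. -/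
def s (x : X) : Inn X := ⟨op (Rack.act' x), Subgroup.subset_closure ⟨x, rfl⟩⟩

lemma actInn_s (a x : X) : actInn a (s x) = x ◃ a := rfl

variable (X) in
/-- Two points are equivalent when they lie in the same orbit of `Inn X`. -/
def orbitSetoid : Setoid X where
  r x y := ∃ g : Inn X, actInn x g = y
  iseqv :=
    { refl := fun x => ⟨1, rfl⟩
      symm := by
        rintro x _ ⟨g, rfl⟩
        exact ⟨g⁻¹, by rw [← actInn_mul, mul_inv_cancel, actInn_one]⟩
      trans := by
        rintro x _ _ ⟨g, rfl⟩ ⟨h, rfl⟩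
        exact ⟨g * h, actInn_mul x g h⟩ }

variable (X) in
/-- The set of connected components (orbits of `Inn X`). -/
def Orbits : Type u := Quotient (orbitSetoid X)

/-- The connected component of a point. -/
def orbit (x : X) : Orbits X := Quotient.mk (orbitSetoid X) x

lemma orbit_act (x y : X) : orbit (y ◃ x) = orbit x :=
  (Quotient.sound (s := orbitSetoid X) ⟨s y, rfl⟩).symm

variable (X) in
/-- The abelianization map `α`, with `e_x ↦ e_{[x]}`. -/
def α : As X →* Multiplicative (Orbits X →₀ ℤ) :=
  PresentedGroup.toGroup (f := fun x => Multiplicative.ofAdd (Finsupp.single (orbit x) 1)) (by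
    rintro r ⟨x, y, rfl⟩
    simp only [map_mul, map_inv, FreeGroup.lift_apply_of, orbit_act]
    rw [mul_inv_eq_one, mul_comm])

variable (X) in
/-- The canonical epimorphism `ψ`, with `e_x ↦ s_x`. -/
def ψ : As X →* Inn X :=
  PresentedGroup.toGroup (f := s) (by
    rintro r ⟨x, y, rfl⟩
    simp only [map_mul, map_inv, FreeGroup.lift_apply_of]
    rw [mul_inv_eq_one]
    apply Subtype.ext
    apply unop_injective
    ext a
    exact Shelf.self_distrib)

@[simp] lemma α_e (x : X) : α X (e x) = Multiplicative.ofAdd (Finsupp.single (orbit x) 1) :=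
  PresentedGroup.toGroup.of _

@[simp] lemma ψ_e (x : X) : ψ X (e x) = s x := PresentedGroup.toGroup.of _

variable (X) in
/-- The homomorphism `α × ψ`. -/
def αψ : As X →* Multiplicative (Orbits X →₀ ℤ) × Inn X := (α X).prod (ψ X)

variable (X) in
/-- The image of `α × ψ`. -/
abbrev InnBar : Subgroup (Multiplicative (Orbits X →₀ ℤ) × Inn X) := (αψ X).range

variable (X) in
/-- The kernel `A` of `α × ψ`. -/
abbrev A : Subgroup (As X) := (αψ X).ker

/-- The element `(α × ψ)(e_x)` of `InnBar X`. -/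
def sBar (x : X) : InnBar X := (αψ X).rangeRestrict (e x)

/-- The stabilizer of `x` in `InnBar X`, which acts on `X` via the second projection. -/
def stab (x : X) : Subgroup (InnBar X) where
  carrier := {g | actInn x g.1.2 = x}
  one_mem' := rfl
  mul_mem' := by
    intro g h hg hh
    simp only [Set.mem_ofPred_eq] at *
    rw [Subgroup.coe_mul, Prod.snd_mul, actInn_mul, hg, hh]
  inv_mem' := by
    intro g hg
    simp only [Set.mem_ofPred_eq] at *
    rw [Subgroup.coe_inv, Prod.snd_inv]
    conv_lhs => rw [← hg]
    rw [← actInn_mul, mul_inv_cancel, actInn_one]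

lemma e_mul_e (x y : X) : e x * e y = e y * e (y ◃ x) := by
  have h : PresentedGroup.mk (rels X) (FreeGroup.of x * FreeGroup.of y *
      (FreeGroup.of y * FreeGroup.of (y ◃ x))⁻¹) = 1 :=
    PresentedGroup.one_of_mem ⟨x, y, rfl⟩
  rw [map_mul, map_inv, mul_inv_eq_one, map_mul, map_mul] at h
  exact h

lemma e_mul (g : As X) : ∀ x : X, e x * g = g * e (actInn x (ψ X g)) := by
  have hg : g ∈ Subgroup.closure (Set.range (PresentedGroup.of : X → As X)) := by
    rw [PresentedGroup.closure_range_of]; trivial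
  induction hg using Subgroup.closure_induction with
  | mem g hg =>
    obtain ⟨y, rfl⟩ := hg
    intro x
    have : ψ X (PresentedGroup.of y) = s y := ψ_e y
    rw [this, actInn_s]
    exact e_mul_e x y
  | one => intro x; simp [actInn_one]
  | mul g h _ _ ihg ihh =>
    intro x
    rw [map_mul, actInn_mul, ← mul_assoc, ihg, mul_assoc, ihh, mul_assoc]
  | inv g _ ih =>
    intro x
    have h := ih (actInn x (ψ X g)⁻¹)
    rw [← actInn_mul, inv_mul_cancel, actInn_one] at h
    rw [map_inv, eq_inv_mul_iff_mul_eq, ← mul_assoc, ← h, mul_inv_cancel_right]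

/-- The kernel of `α × ψ` is central. -/
lemma A_le_center : A X ≤ Subgroup.center (As X) := by
  intro g hg
  have hψ : ψ X g = 1 := congrArg Prod.snd (MonoidHom.mem_ker.1 hg)
  have hc : Subgroup.centralizer {g} = (⊤ : Subgroup (As X)) := by
    rw [eq_top_iff, ← PresentedGroup.closure_range_of, Subgroup.closure_le]
    rintro _ ⟨x, rfl⟩
    rw [SetLike.mem_coe, Subgroup.mem_centralizer_singleton_iff]
    have := e_mul g x
    rw [hψ, actInn_one] at this
    exact this
  rw [Subgroup.mem_center_iff]
  intro h
  have hh : h ∈ Subgroup.centralizer {g} := hc ▸ Subgroup.mem_top h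
  exact Subgroup.mem_centralizer_singleton_iff.1 hh

instance : CommGroup (A X) :=
  { (inferInstance : Group (A X)) with
    mul_comm := fun a b =>
      Subtype.ext ((Subgroup.mem_center_iff.1 (A_le_center b.2)) a.1) }

lemma commute_sBar (x : X) {h : InnBar X} (hh : h ∈ stab x) : Commute (sBar x) h := by
  obtain ⟨_, g, rfl⟩ := h
  apply Subtype.ext
  have h1 := e_mul g x
  have h2 : actInn x (ψ X g) = x := hh
  rw [h2] at h1
  have h3 := congrArg (αψ X) h1
  rw [map_mul, map_mul] at h3
  exact h3

variable (X) in
/-- The subgroup of `H₂(InnBar X)` generated by all Pontryagin products `⟨s̄_x, h⟩` with `x ∈ X`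
and `h` in the stabilizer of `x`. -/
def pontryaginSubgroup : AddSubgroup (H₂ (InnBar X)) :=
  ⨆ x : X, AddSubgroup.closure
    {z | ∃ (h : InnBar X) (hh : h ∈ stab x), z = pontryagin (sBar x) h (commute_sBar x hh)}

variable (X) in
/-- The central extension `1 → A → As(X) → InnBar(X) → 1`. -/
def asExtension : GroupExtension (A X) (As X) (InnBar X) where
  inl := (A X).subtype
  rightHom := (αψ X).rangeRestrict
  inl_injective := Subtype.val_injective
  range_inl_eq_ker_rightHom := by
    rw [Subgroup.range_subtype, MonoidHom.ker_rangeRestrict]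
  rightHom_surjective := (αψ X).rangeRestrict_surjective

end AssocGroup

end

/-! The first projection of `InnBar X` sends `sBar x` to the basis vector of the orbit of `x`, and
`sBar` is constant up to conjugacy on orbits. So `H₁(InnBar X)` is free abelian on the orbits, the
Ext term of universal coefficients vanishes, and evaluation is bijective for all coefficients
(`evaluation_bijective`). As `A` is central, `As X` is given by a cocycle `c`; let `φ` be its
evaluation. By the first isomorphism theorem it remains to find the image and kernel of `φ`.

Image: the class pushed forward to `A / im φ` evaluates to zero, hence is trivial, so the quotient
map of `A` extends to `As X`. Homomorphisms from `As X` to commutative groups factor through `α`,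
which kills `A`; thus `im φ = A`.

Kernel: evaluating a cocycle on a Pontryagin product gives the commutator of lifts (`commute_iff`).
In `As X`, `e x` commutes with all lifts of `stab x`, so `φ` kills these products. Conversely, let
`Q` be `H₂` modulo them and take the extension by `Q` whose class evaluates to the projection `H₂ →
Q`. Its lifts of `sBar x` and `stab x` commute, which is just what makes `As X` map to it over
`InnBar X` (`exists_lift`). Hence the projection factors through `φ`, and `ker φ` contains nothing
more. -/

noncomputable section

/-! ### Split linear maps -/

section LinearAlgebra

variable {R C D M : Type*} [Ring R] [AddCommGroup C] [AddCommGroup D] [AddCommGroup M]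
  [Module R C] [Module R D] [Module R M]

/-- A linear map with projective target and cokernel is split. -/
lemma LinearMap.exists_comp_comp_eq_self_of_projective [Module.Projective R D] (f : C →ₗ[R] D)
    [Module.Projective R (D ⧸ LinearMap.range f)] : ∃ j : D →ₗ[R] C, f ∘ₗ j ∘ₗ f = f := by
  obtain ⟨i, hi⟩ := Module.projective_lifting_property (LinearMap.range f).mkQ .id
    (Submodule.mkQ_surjective _)
  -- Subtracting the lifted quotient part retracts `D` onto `range f`, which is therefore
  -- projective.
  let r : D →ₗ[R] LinearMap.range f :=
    (LinearMap.id - i ∘ₗ (LinearMap.range f).mkQ).codRestrict _ fun x => by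
      rw [← Submodule.Quotient.mk_eq_zero, ← Submodule.mkQ_apply]
      have := LinearMap.congr_fun hi ((LinearMap.range f).mkQ x)
      simp only [LinearMap.comp_apply, LinearMap.id_apply] at this
      simp only [LinearMap.sub_apply, LinearMap.comp_apply, LinearMap.id_apply, map_sub, this,
        sub_self]
  have hr : r ∘ₗ (LinearMap.range f).subtype = .id := by
    ext ⟨_, x, rfl⟩
    have : (LinearMap.range f).mkQ (f x) = 0 :=
      (Submodule.Quotient.mk_eq_zero _).2 (LinearMap.mem_range_self f x)
    simp only [r, LinearMap.comp_apply, Submodule.subtype_apply, LinearMap.codRestrict_apply,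
      LinearMap.sub_apply, LinearMap.id_apply, this, map_zero, sub_zero]
  have : Module.Projective R (LinearMap.range f) := Module.Projective.of_split _ _ hr
  obtain ⟨j, hj⟩ := Module.projective_lifting_property f.rangeRestrict .id
    f.surjective_rangeRestrict
  refine ⟨j ∘ₗ r, LinearMap.ext fun x => ?_⟩
  have h1 : r (f x) = f.rangeRestrict x := LinearMap.congr_fun hr (f.rangeRestrict x)
  have h2 := LinearMap.congr_fun hj (f.rangeRestrict x)
  simp only [LinearMap.comp_apply, h1]
  exact congrArg Subtype.val h2

/-- A linear map that vanishes on the kernel of a split map `f` factors through `f`. -/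
lemma LinearMap.exists_eq_comp_of_ker_le {f : C →ₗ[R] D} {j : D →ₗ[R] C}
    (hj : f ∘ₗ j ∘ₗ f = f) (g : C →ₗ[R] M) (hg : LinearMap.ker f ≤ LinearMap.ker g) :
    ∃ h : D →ₗ[R] M, g = h ∘ₗ f := by
  refine ⟨g ∘ₗ j, LinearMap.ext fun x => ?_⟩
  have : x - j (f x) ∈ LinearMap.ker g := hg <| by
    have := LinearMap.congr_fun hj x
    simp only [LinearMap.comp_apply] at this
    simp [this]
  simpa [sub_eq_zero] using this

/-- A linear map on the kernel of a split map extends to the whole module. -/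
lemma LinearMap.exists_extend_ker {f : C →ₗ[R] D} {j : D →ₗ[R] C}
    (hj : f ∘ₗ j ∘ₗ f = f) (g : LinearMap.ker f →ₗ[R] M) :
    ∃ h : C →ₗ[R] M, h ∘ₗ (LinearMap.ker f).subtype = g := by
  -- `id - j ∘ f` is a projection onto `ker f`.
  refine ⟨g ∘ₗ (LinearMap.id - j ∘ₗ f).codRestrict _ fun x => ?_, LinearMap.ext fun x => ?_⟩
  · simp only [LinearMap.comp_apply]
    refine congrArg g (Subtype.ext ?_)
    simp
  · have := LinearMap.congr_fun hj x
    simp only [LinearMap.comp_apply] at this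
    simp [this]

end LinearAlgebra

/-! ### Universal coefficients in degree two -/

namespace GroupH2

variable {G : Type u} [Group G] {M : Type u} [AddCommGroup M]

variable (G) in
/-- The boundary map from integral 2-chains to integral 1-chains. -/
abbrev boundary : (G × G →₀ Z.{u}) →ₗ[Z.{u}] (G →₀ Z.{u}) :=
  (groupHomology.d₂₁ (Rep.trivial Z.{u} G Z.{u})).hom

lemma boundary_single (g h : G) (n : Z.{u}) : boundary G (Finsupp.single (g, h) n) =
    Finsupp.single h n - Finsupp.single (g * h) n + Finsupp.single g n :=
  groupHomology.d₂₁_single (A := Rep.trivial Z.{u} G Z.{u}) (g, h) n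

lemma evaluation_cocClass (c : Coc G M) :
    evaluation G M (cocClass G M c) = evalCocycle c :=
  AddMonoidHom.liftOfRightInverse_comp_apply _ _ _ _ c

lemma cocClass_eq_zero_iff (c : Coc G M) :
    cocClass G M c = 0 ↔ ∃ b : G → M, ∀ g h, c.1 (g, h) = b h - b (g * h) + b g := by
  refine (groupCohomology.H2π_eq_zero_iff (A := Rep.trivial Z.{u} G M) c).trans ?_
  refine exists_congr fun b => ⟨fun h g k => ?_, fun h => funext fun ⟨g, k⟩ => ?_⟩
  · refine (congrFun h (g, k)).symm.trans ?_
    exact groupCohomology.d₁₂_hom_apply (A := Rep.trivial Z.{u} G M) b (g, k)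
  · refine Eq.trans ?_ (h g k).symm
    exact groupCohomology.d₁₂_hom_apply (A := Rep.trivial Z.{u} G M) b (g, k)

/-- Evaluation is injective when the boundary map from 2-chains to 1-chains splits. -/
lemma evaluation_injective {j : (G →₀ Z.{u}) →ₗ[Z.{u}] (G × G →₀ Z.{u})}
    (hj : boundary G ∘ₗ j ∘ₗ boundary G = boundary G) :
    Function.Injective (evaluation G M) := by
  rw [injective_iff_map_eq_zero]
  intro κ hκ
  obtain ⟨c, rfl⟩ := cocClass_surjective κ
  rw [evaluation_cocClass] at hκ
  -- The pairing vanishes on cycles, so it factors through the boundary; the factor is a 1-cochain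
  -- with coboundary `c`.
  obtain ⟨b, hb⟩ := LinearMap.exists_eq_comp_of_ker_le hj (pair c.1) fun z hz => by
    rw [LinearMap.mem_ker, ← evalCocycle_cycClass c ⟨z, hz⟩, hκ, AddMonoidHom.zero_apply]
  rw [cocClass_eq_zero_iff]
  refine ⟨fun g => b (Finsupp.single g 1), fun g h => ?_⟩
  have := LinearMap.congr_fun hb (Finsupp.single (g, h) 1)
  rw [LinearMap.comp_apply, boundary_single, map_add, map_sub] at this
  rw [← this]
  simp [pair]

/-- Evaluation is surjective when the boundary map from 2-chains to 1-chains splits. -/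
lemma evaluation_surjective {j : (G →₀ Z.{u}) →ₗ[Z.{u}] (G × G →₀ Z.{u})}
    (hj : boundary G ∘ₗ j ∘ₗ boundary G = boundary G) :
    Function.Surjective (evaluation G M) := by
  intro f
  let g : LinearMap.ker (boundary G) →ₗ[Z.{u}] M :=
    { toFun := fun z => f (cycClass G z)
      map_add' := (f.comp (cycClass G)).map_add
      map_smul' := fun n x => (f.comp (cycClass G)).map_zsmul n.down x }
  obtain ⟨h, hh⟩ := LinearMap.exists_extend_ker hj g
  have key (z : Cyc G) : h z.1 = f (cycClass G z) := LinearMap.congr_fun hh z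
  -- The cocycle identity says that `h` kills the boundaries of 3-chains, whose classes are zero.
  have hc : (fun p => h (Finsupp.single p 1)) ∈ Coc G M := by
    rw [groupCohomology.mem_cocycles₂_iff]
    intro a b d
    let y : G × G × G →₀ Z.{u} := Finsupp.single (a, b, d) 1
    have hy : groupHomology.d₃₂ (Rep.trivial Z.{u} G Z.{u}) y ∈ Cyc G := by
      have := groupHomology.d₃₂_comp_d₂₁ (Rep.trivial Z.{u} G Z.{u})
      exact congrArg (fun f => f.hom y) this
    have h0 : cycClass G ⟨_, hy⟩ = 0 :=
      (groupHomology.H2π_eq_zero_iff (A := Rep.trivial Z.{u} G Z.{u}) _).2 ⟨y, rfl⟩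
    have h1 := key ⟨_, hy⟩
    rw [h0, map_zero] at h1
    have h2 : groupHomology.d₃₂ (Rep.trivial Z.{u} G Z.{u}) y =
        (Finsupp.single (b, d) 1 - Finsupp.single (a * b, d) 1 + Finsupp.single (a, b * d) 1 -
          Finsupp.single (a, b) 1 : G × G →₀ Z.{u}) :=
      groupHomology.d₃₂_single (A := Rep.trivial Z.{u} G Z.{u}) (a, b, d) 1
    simp only [h2, map_sub, map_add] at h1
    rw [sub_eq_zero, sub_add_eq_add_sub, sub_eq_iff_eq_add] at h1
    exact (add_comm _ _).trans h1.symm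
  refine ⟨cocClass G M ⟨_, hc⟩, AddMonoidHom.ext fun x => ?_⟩
  obtain ⟨z, rfl⟩ := cycClass_surjective x
  rw [evaluation_cocClass, evalCocycle_cycClass, ← key]
  have : pair (fun p => h (Finsupp.single p 1)) = h := by
    ext p
    simp [pair]
  exact LinearMap.congr_fun this z.1

/-- The universal coefficient theorem in degree two, when the first homology is projective. -/
theorem evaluation_bijective
    [Module.Projective Z.{u} ((G →₀ Z.{u}) ⧸ LinearMap.range (boundary G))] :
    Function.Bijective (evaluation G M) := by
  obtain ⟨j, hj⟩ := (boundary G).exists_comp_comp_eq_self_of_projective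
  exact ⟨evaluation_injective hj, evaluation_surjective hj⟩

end GroupH2

/-! ### Cocycles and central extensions -/

namespace GroupH2

variable {G : Type u} [Group G] {N N' : Type u} [CommGroup N] [CommGroup N']

lemma evaluation_pontryagin {M : Type u} [AddCommGroup M] (c : Coc G M) {g h : G}
    (hgh : Commute g h) :
    evaluation G M (cocClass G M c) (pontryagin g h hgh) = c.1 (g, h) - c.1 (h, g) := by
  rw [evaluation_cocClass, pontryagin, evalCocycle_cycClass]
  simp [pair]

/-- A homomorphism of coefficients composed with a cocycle. -/
def mapCoc {M M' : Type u} [AddCommGroup M] [AddCommGroup M'] (f : M →+ M') (c : Coc G M) :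
    Coc G M' :=
  ⟨fun p => f (c.1 p), (groupCohomology.mem_cocycles₂_iff (A := Rep.trivial Z.{u} G M') _).2
    fun g h j => by
      have := congrArg f (coc_eq c g h j)
      rw [map_add, map_add] at this
      exact this⟩

lemma mapCoc_apply {M M' : Type u} [AddCommGroup M] [AddCommGroup M'] (f : M →+ M')
    (c : Coc G M) (p : G × G) : (mapCoc f c).1 p = f (c.1 p) := rfl

lemma evaluation_mapCoc {M M' : Type u} [AddCommGroup M] [AddCommGroup M'] (f : M →+ M')
    (c : Coc G M) : evaluation G M' (cocClass G M' (mapCoc f c)) =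
      f.comp (evaluation G M (cocClass G M c)) := by
  ext x
  obtain ⟨z, rfl⟩ := cycClass_surjective x
  rw [AddMonoidHom.comp_apply, evaluation_cocClass_cycClass, evaluation_cocClass_cycClass,
    Finsupp.sum, Finsupp.sum, map_sum]
  exact Finset.sum_congr rfl fun p _ => (f.map_zsmul _ _).symm

namespace CocycleGroup

/-- The kernel is central, so the commutator of two lifts depends only on `g` and `h`; it is `c (g,
h) - c (h, g)`. -/
lemma commute_iff {c : Coc G (Additive N)} {u v : CocycleGroup c} {g h : G}
    (hgh : Commute g h) (hu : u.right = g) (hv : v.right = h) :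
    Commute u v ↔
      evaluation G (Additive N) (cocClass G (Additive N) c) (pontryagin g h hgh) = 0 := by
  subst hu hv
  rw [evaluation_pontryagin, sub_eq_zero]
  change _ ↔ mulCoc c u.right v.right = mulCoc c v.right u.right
  constructor
  · intro huv
    have := congrArg left huv
    simp only [mul_left] at this
    rw [mul_comm v.left] at this
    exact mul_left_cancel this
  · intro huv
    ext
    · simp only [mul_left]
      rw [huv, mul_comm v.left]
    · exact hgh

lemma inl_left_mul (c : Coc G (Additive N)) (a : N) (u : CocycleGroup c) :
    (cocycleExtension c).inl a * u = ⟨a * u.left, u.right⟩ := by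
  ext
  · change a * (mulCoc c 1 1)⁻¹ * u.left * mulCoc c 1 u.right = _
    rw [mulCoc_one_left c u.right, mul_right_comm _ u.left, inv_mul_cancel_right]
  · change 1 * u.right = _
    rw [one_mul]

/-- A homomorphism of extensions relates the evaluations of the two cocycles. -/
lemma exists_evaluation_eq_comp {c : Coc G (Additive N)} {c' : Coc G (Additive N')}
    (F : CocycleGroup c →* CocycleGroup c') (hF : ∀ u, (F u).right = u.right) :
    ∃ f : Additive N →+ Additive N', evaluation G (Additive N') (cocClass G (Additive N') c') =
      f.comp (evaluation G (Additive N) (cocClass G (Additive N) c)) := by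
  have h (a : N) : ∃ b : N', (cocycleExtension c').inl b = F ((cocycleExtension c).inl a) := by
    have : F ((cocycleExtension c).inl a) ∈ (cocycleExtension c').rightHom.ker :=
      hF ((cocycleExtension c).inl a)
    rwa [← (cocycleExtension c').range_inl_eq_ker_rightHom] at this
  choose k hk using h
  let f : N →* N' := MonoidHom.mk' k fun a b => (cocycleExtension c').inl_injective <| by
    rw [map_mul, hk, hk, hk, map_mul, map_mul]
  have hf (a : N) : (cocycleExtension c').inl (f a) = F ((cocycleExtension c).inl a) := hk a
  refine ⟨f.toAdditive, ?_⟩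
  rw [← evaluation_mapCoc, ← sub_eq_zero, ← map_sub, ← map_sub]
  refine (congrArg _ ?_).trans (map_zero _)
  rw [cocClass_eq_zero_iff]
  -- Computing `F (⟨1, g⟩ * ⟨1, h⟩)` in two ways shows that `c'` and the pushforward of `c` differ
  -- by this coboundary.
  refine ⟨fun g => -Additive.ofMul (F ⟨1, g⟩).left, fun g h => ?_⟩
  have h1 : (⟨1, g⟩ * ⟨1, h⟩ : CocycleGroup c) =
      (cocycleExtension c).inl (mulCoc c g h) * ⟨1, g * h⟩ := by
    rw [inl_left_mul]
    ext <;> simp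
  have h2 := congrArg left (congrArg F h1)
  rw [map_mul, map_mul, ← hf, inl_left_mul, mul_left, hF, hF] at h2
  have h3 : Additive.ofMul (F ⟨1, g⟩).left + Additive.ofMul (F ⟨1, h⟩).left + c'.1 (g, h) =
      f.toAdditive (c.1 (g, h)) + Additive.ofMul (F ⟨1, g * h⟩).left := h2
  change c'.1 (g, h) - f.toAdditive (c.1 (g, h)) = _
  generalize f.toAdditive (c.1 (g, h)) = y at h3 ⊢
  change _ = -_ - -_ + -_
  rw [← eq_sub_iff_add_eq'] at h3
  rw [h3]
  abel

/-- If pushing a cocycle forward along `f` gives a coboundary, then `f` extends to the extension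
group. -/
lemma exists_extension {M : Type u} [AddCommGroup M] {c : Coc G (Additive N)}
    (f : Additive N →+ M) (hc : cocClass G M (mapCoc f c) = 0) :
    ∃ F : CocycleGroup c →* Multiplicative M, ∀ a : N,
      F ((cocycleExtension c).inl a) = Multiplicative.ofAdd (f (Additive.ofMul a)) := by
  obtain ⟨b, hb⟩ := (cocClass_eq_zero_iff _).1 hc
  simp only [mapCoc_apply] at hb
  -- The cochain `b` corrects the failure of `(a, g) ↦ f a` to be multiplicative. On the kernel, `b
  -- 1 = f (c (1, 1))` cancels the factor in `inl` due to `c` being unnormalized.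
  refine ⟨MonoidHom.mk'
    (fun u => Multiplicative.ofAdd (f (Additive.ofMul u.left) + b u.right)) fun u v => ?_,
    fun a => ?_⟩
  · apply Multiplicative.toAdd.injective
    change f (Additive.ofMul u.left + Additive.ofMul v.left + c.1 (u.right, v.right)) +
      b (u.right * v.right) = f (Additive.ofMul u.left) + b u.right +
        (f (Additive.ofMul v.left) + b v.right)
    rw [map_add, map_add, hb]
    abel
  · apply Multiplicative.toAdd.injective
    change f (Additive.ofMul a + -c.1 (1, 1)) + b 1 = f (Additive.ofMul a)
    rw [map_add, map_neg, hb, mul_one]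
    abel

end CocycleGroup

/-- Every central extension is associated with some cocycle. -/
lemma exists_equiv_cocycleExtension {E : Type u} [Group E] (S : GroupExtension N E G)
    (hS : ∀ a x, Commute (S.inl a) x) :
    ∃ c : Coc G (Additive N), Nonempty (S.Equiv (cocycleExtension c)) := by
  choose σ hσ using S.rightHom_surjective
  have h (g h : G) : ∃ a, S.inl a = σ g * σ h * (σ (g * h))⁻¹ := by
    have : σ g * σ h * (σ (g * h))⁻¹ ∈ S.rightHom.ker := by
      rw [MonoidHom.mem_ker, map_mul, map_mul, map_inv, hσ, hσ, hσ, mul_inv_cancel]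
    rwa [← S.range_inl_eq_ker_rightHom] at this
  choose c hc using h
  have hc' (g h : G) : σ g * σ h = S.inl (c g h) * σ (g * h) := by
    rw [hc, inv_mul_cancel_right]
  -- This is associativity of `σ g * σ h * σ j`, with centrality used to move the kernel factors.
  have hcoc : (fun p => Additive.ofMul (c p.1 p.2)) ∈ Coc G (Additive N) := by
    rw [groupCohomology.mem_cocycles₂_iff]
    intro g h j
    change c (g * h) j * c g h = c h j * c g (h * j)
    apply S.inl_injective
    apply mul_right_cancel (b := σ (g * h * j))
    have hl : S.inl (c g h) * (S.inl (c (g * h) j) * σ (g * h * j)) = σ g * σ h * σ j := by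
      rw [← hc', ← mul_assoc, ← hc']
    have hr : S.inl (c h j) * (S.inl (c g (h * j)) * σ (g * (h * j))) = σ g * σ h * σ j := by
      rw [← hc', ← mul_assoc, (hS _ _).eq, mul_assoc, ← hc', mul_assoc]
    rw [mul_comm, map_mul, mul_assoc, hl, map_mul, mul_assoc g h j, mul_assoc (S.inl _), hr]
  let e : CocycleGroup (⟨_, hcoc⟩ : Coc G (Additive N)) ≃* E :=
    MulEquiv.ofBijective (MonoidHom.mk' (fun u => S.inl u.left * σ u.right) fun u v => by
      change S.inl (u.left * v.left * c u.right v.right) * σ (u.right * v.right) = _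
      rw [map_mul, map_mul, mul_assoc, ← hc', mul_assoc, ← mul_assoc (S.inl v.left),
        (hS v.left _).eq, mul_assoc, mul_assoc]) <| by
      constructor
      · intro u v huv
        change S.inl u.left * σ u.right = S.inl v.left * σ v.right at huv
        have h1 := congrArg S.rightHom huv
        simp only [map_mul, S.rightHom_inl, hσ, one_mul] at h1
        rw [h1] at huv
        exact CocycleGroup.ext (S.inl_injective (mul_right_cancel huv)) h1
      · intro x
        have : x * (σ (S.rightHom x))⁻¹ ∈ S.rightHom.ker := by
          rw [MonoidHom.mem_ker, map_mul, map_inv, hσ, mul_inv_cancel]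
        rw [← S.range_inl_eq_ker_rightHom] at this
        obtain ⟨a, ha⟩ := this
        refine ⟨⟨a, S.rightHom x⟩, ?_⟩
        change S.inl a * σ (S.rightHom x) = x
        rw [ha, inv_mul_cancel_right]
  have he (u) : e u = S.inl u.left * σ u.right := rfl
  refine ⟨⟨_, hcoc⟩, ⟨GroupExtension.Equiv.symm
    { e with inl_comm := funext fun a => ?_, rightHom_comm := funext fun u => ?_ }⟩⟩
  · change S.inl (a * (c 1 1)⁻¹) * σ 1 = S.inl a
    -- The section need not send `1` to `1`; the factor `(c 1 1)⁻¹` compensates.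
    have : S.inl (c 1 1) = σ 1 := by
      have := hc' 1 1
      rw [mul_one] at this
      exact (mul_right_cancel this).symm
    rw [map_mul, map_inv, this, inv_mul_cancel_right]
  · change S.rightHom (S.inl u.left * σ u.right) = u.right
    rw [map_mul, S.rightHom_inl, one_mul, hσ]

end GroupH2

/-! ### First homology of `InnBar X` and lifts of `As X` -/

namespace AssocGroup

open MulOpposite GroupH2

variable {X : Type u} [Rack X]

lemma sBar_mul (x : X) (g : InnBar X) : sBar x * g = g * sBar (actInn x g.1.2) := by
  obtain ⟨_, a, rfl⟩ := g
  exact Subtype.ext ((map_mul (αψ X) _ _).symm.trans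
    ((congrArg (αψ X) (e_mul a x)).trans (map_mul (αψ X) _ _)))

lemma sBar_snd (x : X) : (sBar x).1.2 = s x := ψ_e x

lemma ψ_surjective : Function.Surjective (ψ X) := by
  rintro ⟨g, hg⟩
  induction hg using Subgroup.closure_induction with
  | mem g hg =>
    obtain ⟨x, rfl⟩ := hg
    exact ⟨e x, ψ_e x⟩
  | one => exact ⟨1, map_one _⟩
  | mul g h _ _ ihg ihh =>
    obtain ⟨a, ha⟩ := ihg
    obtain ⟨b, hb⟩ := ihh
    exact ⟨a * b, by rw [map_mul, ha, hb]; rfl⟩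
  | inv g _ ih =>
    obtain ⟨a, ha⟩ := ih
    exact ⟨a⁻¹, by rw [map_inv, ha]; rfl⟩

lemma exists_actInn_out (x : X) : ∃ a : As X, actInn (orbit x).out (ψ X a) = x := by
  obtain ⟨g, hg⟩ : (orbitSetoid X).r (orbit x).out x := Quotient.exact (Quotient.out_eq _)
  obtain ⟨a, rfl⟩ := ψ_surjective g
  exact ⟨a, hg⟩

lemma orbit_actInn (x : X) (g : Inn X) : orbit (actInn x g) = orbit x :=
  (Quotient.sound (s := orbitSetoid X) ⟨g, rfl⟩).symm

/-- A homomorphism to a commutative group is constant on generators in the same orbit. -/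
lemma map_e_out {H : Type*} [CommGroup H] (f : As X →* H) (x : X) :
    f (e (orbit x).out) = f (e x) := by
  obtain ⟨a, ha⟩ := exists_actInn_out x
  have := congrArg f (e_mul a (orbit x).out)
  rw [ha, map_mul, map_mul, mul_comm] at this
  exact mul_left_cancel this

/-- Homomorphisms to commutative groups factor through `α`. -/
lemma map_eq_one_of_α_eq_one {H : Type*} [CommGroup H] (f : As X →* H) {a : As X}
    (ha : α X a = 1) : f a = 1 := by
  let k : (Orbits X →₀ ℤ) →+ Additive H :=
    Finsupp.liftAddHom fun o => zmultiplesHom _ (Additive.ofMul (f (e o.out)))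
  have : f = (AddMonoidHom.toMultiplicativeLeft k).comp (α X) := by
    refine PresentedGroup.ext fun x => ?_
    change f (e x) = AddMonoidHom.toMultiplicativeLeft k (α X (e x))
    rw [α_e, ← map_e_out f]
    simp [k]
  rw [this, MonoidHom.comp_apply, ha, map_one]

lemma InnBar.hom_ext {H : Type*} [Group H] {f g : InnBar X →* H}
    (h : ∀ x, f (sBar x) = g (sBar x)) : f = g :=
  (MonoidHom.cancel_right (αψ X).rangeRestrict_surjective).1 (PresentedGroup.ext h)

/-- The cokernel of the boundary is `H₁(InnBar X)`. It is a retract of the free module on the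
orbits: `s` is induced by the first projection, and `r` sends an orbit to the class of `sBar` at a
representative. That `r ∘ s` is the identity need only be checked on the generators `sBar x`. -/
instance : Module.Projective Z.{u}
    ((InnBar X →₀ Z.{u}) ⧸ LinearMap.range (boundary (InnBar X))) := by
  let B := LinearMap.range (boundary (InnBar X))
  let cl : InnBar X →* Multiplicative ((InnBar X →₀ Z.{u}) ⧸ B) :=
    MonoidHom.mk' (fun g => Multiplicative.ofAdd (B.mkQ (Finsupp.single g 1))) fun g h => by
      apply Multiplicative.toAdd.injective
      change B.mkQ _ = B.mkQ _ + B.mkQ _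
      rw [← map_add, ← sub_eq_zero, ← map_sub, Submodule.mkQ_apply, Submodule.Quotient.mk_eq_zero,
        ← neg_mem_iff]
      refine ⟨Finsupp.single (g, h) 1, ?_⟩
      rw [boundary_single]
      abel
  have hcl (g : InnBar X) : B.mkQ (Finsupp.single g 1) = (cl g).toAdd := rfl
  let π : InnBar X → Orbits X →₀ Z.{u} := fun g =>
    Finsupp.mapRange.addMonoidHom AddEquiv.ulift.symm.toAddMonoidHom g.1.1.toAdd
  have hπ (g h : InnBar X) : π (g * h) = π g + π h := map_add _ _ _
  let s : ((InnBar X →₀ Z.{u}) ⧸ B) →ₗ[Z.{u}] (Orbits X →₀ Z.{u}) :=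
    B.liftQ (Finsupp.linearCombination Z.{u} π) <| by
      rintro _ ⟨z, rfl⟩
      have : Finsupp.linearCombination Z.{u} π ∘ₗ boundary (InnBar X) = 0 := by
        ext1 ⟨g, h⟩
        ext1
        simp only [LinearMap.comp_apply, Finsupp.lsingle_apply, boundary_single, map_add, map_sub,
          Finsupp.linearCombination_single, hπ, one_smul, LinearMap.zero_apply]
        abel
      exact LinearMap.congr_fun this z
  let r : (Orbits X →₀ Z.{u}) →ₗ[Z.{u}] ((InnBar X →₀ Z.{u}) ⧸ B) :=
    Finsupp.linearCombination Z.{u} fun o => (cl (sBar o.out)).toAdd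
  have hs (g : InnBar X) : s (cl g).toAdd = π g := by
    rw [← hcl]
    simp [s]
  have hrπ : (MonoidHom.mk' (fun g => Multiplicative.ofAdd (r (π g))) fun g h => by
      rw [hπ, map_add, ofAdd_add] : InnBar X →* _) = cl := by
    refine InnBar.hom_ext fun x => ?_
    have h1 : π (sBar x) = Finsupp.single (orbit x) 1 := by
      change Finsupp.mapRange.addMonoidHom _ (α X (e x)).toAdd = _
      rw [α_e, toAdd_ofAdd, Finsupp.mapRange.addMonoidHom_apply, Finsupp.mapRange_single]
      rfl
    change Multiplicative.ofAdd (r (π (sBar x))) = _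
    rw [h1, Finsupp.linearCombination_single, one_smul]
    exact map_e_out (cl.comp (αψ X).rangeRestrict) x
  refine Module.Projective.of_split s r ?_
  ext1
  ext1 g
  ext1
  change r (s (cl g).toAdd) = (cl g).toAdd
  rw [hs]
  exact congrArg Multiplicative.toAdd (DFunLike.congr_fun hrπ g)

/-- If in a group over `InnBar X` the lifts of `sBar x` commute with the lifts of the elements of
`stab x`, then the associated group lifts to it. -/
lemma exists_lift {E : Type*} [Group E] (p : E →* InnBar X) (hp : Function.Surjective p)
    (hcomm : ∀ x u v, p u = sBar x → p v ∈ stab x → Commute u v) :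
    ∃ f : As X →* E, ∀ a, p (f a) = (αψ X).rangeRestrict a := by
  have h (x : X) : ∃ u : E, actInn (orbit x).out (p u).1.2 = x := by
    obtain ⟨a, ha⟩ := exists_actInn_out x
    obtain ⟨u, hu⟩ := hp ((αψ X).rangeRestrict a)
    exact ⟨u, by rw [hu]; exact ha⟩
  choose w hw using h
  choose σ hσ using hp
  -- One lift is chosen at the base point of each orbit and transported by conjugation; independent
  -- lifts of the `sBar x` need not satisfy the relations.
  let t (x : X) : E := (w x)⁻¹ * σ (sBar (orbit x).out) * w x
  have hpt (x : X) : p (t x) = sBar x := by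
    simp only [t, map_mul, map_inv, hσ]
    rw [mul_assoc, sBar_mul, hw, inv_mul_cancel_left]
  have ht (x : X) (v : E) : t x * v = v * t (actInn x (p v).1.2) := by
    simp only [t]
    have hy := hw (actInn x (p v).1.2)
    rw [orbit_actInn] at hy ⊢
    set y := actInn x (p v).1.2 with hy'
    -- The second element moves the base point to `x`, then to `y`, then back, so it lies over the
    -- stabilizer.
    have hc : Commute (σ (sBar (orbit x).out)) (w x * v * (w y)⁻¹) := by
      refine hcomm (orbit x).out _ _ (hσ _) ?_
      change actInn _ (p (w x * v * (w y)⁻¹)).1.2 = _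
      rw [map_mul, map_mul, map_inv]
      change actInn _ ((p (w x)).1.2 * (p v).1.2 * ((p (w y)).1.2)⁻¹) = _
      rw [actInn_mul, actInn_mul, hw, ← hy']
      refine (congrArg (fun z => actInn z ((p (w y)).1.2)⁻¹) hy).symm.trans ?_
      rw [← actInn_mul, mul_inv_cancel, actInn_one]
    have := hc.eq
    calc _ = (w x)⁻¹ * (σ (sBar (orbit x).out) * (w x * v * (w y)⁻¹)) * w y := by group
      _ = _ := by rw [this]; group
  refine ⟨PresentedGroup.toGroup (f := t) ?_, fun a => ?_⟩
  · rintro _ ⟨x, y, rfl⟩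
    simp only [map_mul, map_inv, FreeGroup.lift_apply_of]
    -- The defining relation is the equivariance `ht` at `v = t y`.
    rw [mul_inv_eq_one, ht, hpt, sBar_snd, actInn_s]
  · refine DFunLike.congr_fun (?_ : p.comp _ = _) a
    refine PresentedGroup.ext fun x => ?_
    rw [MonoidHom.comp_apply, PresentedGroup.toGroup.of]
    exact hpt x

/-! ### Image and kernel of the evaluation of `As X` -/

variable {c : Coc (InnBar X) (Additive (A X))}

lemma right_equiv (S : (asExtension X).Equiv (cocycleExtension c)) (a : As X) :
    (S a).right = (αψ X).rangeRestrict a := S.rightHom_map a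

lemma evaluation_asExtension_surjective (S : (asExtension X).Equiv (cocycleExtension c)) :
    Function.Surjective (evaluation (InnBar X) (Additive (A X)) (cocClass _ _ c)) := by
  set φ := evaluation (InnBar X) (Additive (A X)) (cocClass _ _ c) with hφ
  let q := QuotientAddGroup.mk' φ.range
  -- Modulo its own image the evaluation is zero, and evaluation is injective on classes.
  have hq : cocClass _ _ (mapCoc q c) = 0 := by
    apply evaluation_bijective.1
    rw [map_zero, evaluation_mapCoc, ← hφ]
    exact AddMonoidHom.ext fun x => (QuotientAddGroup.eq_zero_iff _).2 ⟨x, rfl⟩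
  obtain ⟨F, hF⟩ := CocycleGroup.exists_extension q hq
  intro a
  have h1 : (F.comp S.toMulEquiv.toMonoidHom) a.toMul.1 = 1 :=
    map_eq_one_of_α_eq_one _ (congrArg Prod.fst (MonoidHom.mem_ker.1 a.toMul.2))
  have h2 : S a.toMul.1 = (cocycleExtension c).inl a.toMul := S.map_inl a.toMul
  have h3 : F (S a.toMul.1) = 1 := h1
  rw [h2, hF] at h3
  exact (QuotientAddGroup.eq_zero_iff a).1 h3

lemma ker_evaluation_asExtension (S : (asExtension X).Equiv (cocycleExtension c)) :
    (evaluation (InnBar X) (Additive (A X)) (cocClass _ _ c)).ker = pontryaginSubgroup X := by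
  apply le_antisymm
  · let Q := H₂ (InnBar X) ⧸ pontryaginSubgroup X
    -- This is the universal extension for the problem: its kernel is `H₂` modulo exactly the
    -- obstructions to lifting `As X`.
    obtain ⟨κ, hκ⟩ := evaluation_bijective.2
      ((AddEquiv.additiveMultiplicative Q).symm.toAddMonoidHom.comp
        (QuotientAddGroup.mk' (pontryaginSubgroup X)))
    obtain ⟨c', rfl⟩ := cocClass_surjective κ
    obtain ⟨f, hf⟩ := exists_lift (cocycleExtension c').rightHom
      (cocycleExtension c').rightHom_surjective fun x u v hu hv => by
        rw [CocycleGroup.commute_iff (commute_sBar x hv) hu rfl, hκ]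
        refine (QuotientAddGroup.eq_zero_iff _).2 ?_
        exact (le_iSup (fun x : X => AddSubgroup.closure {z | ∃ (h : InnBar X) (hh : h ∈ stab x),
          z = pontryagin (sBar x) h (commute_sBar x hh)}) x)
          (AddSubgroup.subset_closure ⟨_, hv, rfl⟩)
    -- The lift restricts to `k` on the kernels, so the projection to `Q` is `k` after the
    -- evaluation of `c`.
    obtain ⟨k, hk⟩ := CocycleGroup.exists_evaluation_eq_comp
      (f.comp S.symm.toMulEquiv.toMonoidHom) fun u => (hf _).trans (S.symm.rightHom_map u)
    intro z hz
    rw [AddMonoidHom.mem_ker] at hz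
    have h0 := DFunLike.congr_fun (hκ.symm.trans hk) z
    rw [AddMonoidHom.comp_apply, AddMonoidHom.comp_apply, hz, map_zero] at h0
    exact (QuotientAddGroup.eq_zero_iff z).1 h0
  · refine iSup_le fun x => (AddSubgroup.closure_le _).2 ?_
    rintro _ ⟨h, hh, rfl⟩
    obtain ⟨a, rfl⟩ := (αψ X).rangeRestrict_surjective h
    refine (CocycleGroup.commute_iff _ (right_equiv S (e x)) (right_equiv S a)).1 ?_
    have h1 := e_mul a x
    rw [show actInn x (ψ X a) = x from hh] at h1
    exact Commute.map h1 S.toMulEquiv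

end AssocGroup

end

/-- For every rack `X`: evaluation `H²(InnBar X, A) → Hom(H₂(InnBar X), A)` is an isomorphism, and
there is an isomorphism `θ` from the quotient of `H₂(InnBar X)` by the Pontryagin products onto `A`
such that the central extension `A → As(X) → InnBar X` is the one associated with the class
corresponding to the projection `H₂(InnBar X) → A`. -/
theorem theorem3p1 (X : Type u) [Rack X] :
    Function.Bijective
      (GroupH2.evaluation (AssocGroup.InnBar X) (Additive (AssocGroup.A X))) ∧
    ∃ θ : (GroupH2.H₂ (AssocGroup.InnBar X) ⧸ AssocGroup.pontryaginSubgroup X) ≃+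
        Additive (AssocGroup.A X),
      ∃ κ : GroupH2.Hc₂ (AssocGroup.InnBar X) (Additive (AssocGroup.A X)),
        GroupH2.evaluation (AssocGroup.InnBar X) (Additive (AssocGroup.A X)) κ =
          θ.toAddMonoidHom.comp (QuotientAddGroup.mk' (AssocGroup.pontryaginSubgroup X)) ∧
        GroupH2.HasClass (AssocGroup.asExtension X) κ := by
  refine ⟨GroupH2.evaluation_bijective, ?_⟩
  obtain ⟨c, ⟨S⟩⟩ := GroupH2.exists_equiv_cocycleExtension (AssocGroup.asExtension X)
    fun a x => (Subgroup.mem_center_iff.1 (AssocGroup.A_le_center a.2) x).symm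
  refine ⟨(QuotientAddGroup.quotientAddEquivOfEq
      (AssocGroup.ker_evaluation_asExtension S).symm).trans
    (QuotientAddGroup.quotientKerEquivOfSurjective _
      (AssocGroup.evaluation_asExtension_surjective S)), _, ?_, c, rfl, ⟨S⟩⟩
  rfl
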